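/- **Setting.** Let $V$ be a finite set. An *independence model* $\mathcal J$ over $V$ is a set of triples $\langle A,B\,|\,C\rangle$ of pairwise disjoint subsets of $V$ that contains all triples with $A=\varnothing$ or $B=\varnothing$; singletons are written without braces. It is a *compositional graphoid* if for all pairwise disjoint $A,B,C,D\subseteq V$: (symmetry) $\langle A,B|C\rangle\in\mathcal J\iff\langle B,A|C\rangle\in\mathcal J$; (decomposition) $\langle A,B\cup D|C\rangle\in\mathcal J$ implies $\langle A,B|C\rangle,\langle A,D|C\rangle\in\mathcal J$; (weak union) $\langle A,B\cup D|C\rangle\in\mathcal J$ implies $\langle A,B|C\cup D\rangle,\langle A,D|C\cup B\rangle\in\mathcal J$; and $\langle A,B\cup D|C\rangle\in\mathcal J$ follows from each of (contraction) $\langle A,B|C\cup D\rangle,\langle A,D|C\rangle\in\mathcal J$, (intersection) $\langle A,B|C\cup D\rangle,\langle A,D|C\cup B\rangle\in\mathcal J$, (composition) $\langle A,B|C\rangle,\langle A,D|C\rangle\in\mathcal J$. The *skeleton* $\mathrm{sk}(\mathcal J)$ is the undirected graph on $V$ in which distinct $i,j$ are adjacent iff there is no $C\subseteq V\setminus\{i,j\}$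 with $\langle i,j|C\rangle\in\mathcal J$ or $\langle j,i|C\rangle\in\mathcal J$ (for symmetric $\mathcal J$ the two are the same). **Graphs.** A *mixed graph* $G$ on $V$ has no loops and has edges of three types: lines $i - j$, arrows $i\to j$ and arcs $i\leftrightarrow j$; an arrow has an arrowhead at $j$, an arc at both ends. Its skeleton $\mathrm{sk}(G)$ joins $i$ and $j$ iff there is an edge of some type between them. A walk may repeat nodes and edges. A node $i\ne j$ is an *anterior* of $j$ if there is a walk from $i$ to $j$ all of whose edges are lines or arrows pointing in the direction of the walk. A *section* of a walk is a maximal subwalk consisting only of lines (possibly a single node); it is a *collider section* if the walk continues on both sides of it by edges with an arrowhead at the section. A walk is *connecting* given $C$ if every collider section has a node in $C$ and all other sections are disjoint from $C$. For pairwise disjoint $A,B,C$, $A$ and $B$ are *separated* given $C$ if there is no walk connecting given $C$ between a node of $A$ and a node of $B$. **Preorders.** For a preorder $\lesssim$ on $V$ write $a\sim b$ if $a\lesssim b$ and $b\lesssim a$, and $a<b$ if $a\lesssim b$ and $a\not\sim b$. The graph $G(\mathcal J,\lesssim)$ is obtained from $\mathrm{sk}(\mathcal J)$ by making each edge $ij$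 a line if $i\sim j$, an arrow $i\to j$ if $j<i$, and an arc if $i$ and $j$ are incomparable. The preorder is *$\mathcal J$-compatible* if it is the minimal preorder for $G(\mathcal J,\lesssim)$, i.e. $i\lesssim j$ holds iff $i=j$ or $j$ is an anterior of $i$ in $G(\mathcal J,\lesssim)$. With respect to $\lesssim$, $\mathcal J$ satisfies - *ordered upward-stability* if $\langle i,j|C\rangle\in\mathcal J$ implies $\langle i,j|C\cup\{k\}\rangle\in\mathcal J$ for every $k\in V\setminus\{i,j\}$ such that $l\lesssim k$ for some $l\in\{i,j\}$ or $l\sim k$ for some $l\in C$; - *ordered downward-stability* if $\langle i,j|C\rangle\in\mathcal J$ implies $\langle i,j|C\setminus\{k\}\rangle\in\mathcal J$ for every $k\in V\setminus\{i,j\}$ such that $l\not\lesssim k$ for every $l\in\{i,j\}$ and $l\not<k$ for every $l\in C\setminus\{k\}$. **Theorem.** Let $\mathcal J$ be an independence model over a finite set $V$ that is a compositional graphoid, and let $\lesssim$ be a $\mathcal J$-compatible preorder on $V$ with respect to which $\mathcal J$ satisfies ordered upward- and downward-stability. Then $\mathcal J$ is minimally Markov to $G(\mathcal J,\lesssim)$;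 that is: 1. (global Markov property) for all pairwise disjoint $A,B,C\subseteq V$, if $A$ and $B$ are separated given $C$ in $G(\mathcal J,\lesssim)$, then $\langle A,B|C\rangle\in\mathcal J$; and 2. $\mathrm{sk}(G(\mathcal J,\lesssim))=\mathrm{sk}(\mathcal J)$. -/

import Mathlib

namespace IndepGraph

/-! ## Mixed graphs, walks and separation -/

/-- A mixed graph without loops, with lines `i — j`, arrows `i → j` and arcs `i ↔ j`.
Edges of different types between the same two nodes are allowed. -/
structure MixedGraph (V : Type*) where
  line : V → V → Prop
  arrow : V → V → Prop
  arc : V → V → Prop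
  line_symm : ∀ i j, line i j → line j i
  arc_symm : ∀ i j, arc i j → arc j i
  line_irrefl : ∀ i, ¬ line i i
  arrow_irrefl : ∀ i, ¬ arrow i i
  arc_irrefl : ∀ i, ¬ arc i i

/-- The way an edge is traversed by a walk: a line, an arrow in its direction (`fwd`), an arrow
against its direction (`bwd`), or an arc. -/
inductive Mark where
  | line
  | fwd
  | bwd
  | arc

/-- `e.HeadAtSource`: going from `i` to `j` along an edge traversed as `e`, there is an arrowhead
at `i`. -/
def Mark.HeadAtSource (e : Mark) : Prop := e = Mark.bwd ∨ e = Mark.arc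

/-- `e.HeadAtTarget`: going from `i` to `j` along an edge traversed as `e`, there is an arrowhead
at `j`. -/
def Mark.HeadAtTarget (e : Mark) : Prop := e = Mark.fwd ∨ e = Mark.arc

/-- `G.Edge i e j`: the graph has an edge between `i` and `j` that is traversed as `e` when one
goes from `i` to `j`. -/
def MixedGraph.Edge {V : Type*} (G : MixedGraph V) (i : V) : Mark → V → Prop
  | Mark.line, j => G.line i j
  | Mark.fwd, j => G.arrow i j
  | Mark.bwd, j => G.arrow j i
  | Mark.arc, j => G.arc i j

/-- The skeleton: `i` and `j` are joined if there is an edge of any type between them. -/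
def MixedGraph.skeleton {V : Type*} (G : MixedGraph V) : SimpleGraph V where
  Adj i j := G.line i j ∨ G.arrow i j ∨ G.arrow j i ∨ G.arc i j
  symm := ⟨by
    rintro i j (h | h | h | h)
    · exact Or.inl (G.line_symm i j h)
    · exact Or.inr (Or.inr (Or.inl h))
    · exact Or.inr (Or.inl h)
    · exact Or.inr (Or.inr (Or.inr (G.arc_symm i j h)))⟩
  loopless := ⟨by
    rintro i (h | h | h | h)
    · exact G.line_irrefl i h
    · exact G.arrow_irrefl i h
    · exact G.arrow_irrefl i h
    · exact G.arc_irrefl i h⟩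

/-- `G.IsWalk v₀ [(e₁, v₁), …, (eₖ, vₖ)] j`: the list `⟨v₀, e₁, v₁, …, eₖ, vₖ⟩` is a walk in `G`
from `v₀` to `vₖ = j`. -/
inductive MixedGraph.IsWalk {V : Type*} (G : MixedGraph V) : V → List (Mark × V) → V → Prop
  | nil (i : V) : G.IsWalk i [] i
  | cons {i k j : V} {e : Mark} {w : List (Mark × V)} :
      G.Edge i e k → G.IsWalk k w j → G.IsWalk i ((e, k) :: w) j

/-- The last node of the walk that starts at `i` and continues by `w`. -/
def lastNode {V : Type*} (i : V) : List (Mark × V) → V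
  | [] => i
  | (_, k) :: w => lastNode k w

/-- All edges of the walk are lines. -/
def IsUndirected {V : Type*} (w : List (Mark × V)) : Prop :=
  ∀ x ∈ w, x.1 = Mark.line

/-- The walk has at least one arrow, no arcs, and all its arrows point forwards. -/
def IsSemiDirected {V : Type*} (w : List (Mark × V)) : Prop :=
  (∃ x ∈ w, x.1 = Mark.fwd) ∧ ∀ x ∈ w, x.1 = Mark.line ∨ x.1 = Mark.fwd

/-- `i` is an anterior of `j`: there is an anterior (undirected or semi-directed) walk from `i`
to `j`. A node is not an anterior of itself. -/
def MixedGraph.IsAnterior {V : Type*} (G : MixedGraph V) (i j : V) : Prop :=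
  i ≠ j ∧ ∃ w, G.IsWalk i w j ∧ (IsSemiDirected w ∨ IsUndirected w)

/-- The splitting `w = p ++ s ++ q` exhibits `s` as a section of the walk `w`, that is as a
maximal subwalk all of whose edges are lines (a single node if `s = []`). -/
def IsSection {V : Type*} (w p s q : List (Mark × V)) : Prop :=
  w = p ++ s ++ q ∧ IsUndirected s ∧
    (∀ x ∈ p.getLast?, x.1 ≠ Mark.line) ∧ (∀ x ∈ q.head?, x.1 ≠ Mark.line)

/-- The section between the parts `p` and `q` of a walk is a collider section: the walk goes on
at both ends of the section, in both cases with an arrowhead at the section. -/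
def IsCollider {V : Type*} (p q : List (Mark × V)) : Prop :=
  (∃ x ∈ p.getLast?, x.1.HeadAtTarget) ∧ (∃ x ∈ q.head?, x.1.HeadAtSource)

/-- The nodes of the section `s` that comes after the part `p` of a walk starting at `i`. -/
def sectionNodes {V : Type*} (i : V) (p s : List (Mark × V)) : Set V :=
  {x | x = lastNode i p ∨ x ∈ s.map Prod.snd}

/-- The walk that starts at `i` and continues by `w` is connecting given `C`: every collider
section has a node in `C`, and all non-collider sections are disjoint from `C`. -/
def IsConnecting {V : Type*} (i : V) (w : List (Mark × V)) (C : Set V) : Prop :=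
  ∀ p s q, IsSection w p s q →
    (IsCollider p q → (sectionNodes i p s ∩ C).Nonempty) ∧
    (¬ IsCollider p q → Disjoint (sectionNodes i p s) C)

/-- `A` and `B` are separated given `C` (used for pairwise disjoint `A`, `B`, `C`). -/
def MixedGraph.Separated {V : Type*} (G : MixedGraph V) (A B C : Set V) : Prop :=
  ∀ i ∈ A, ∀ j ∈ B, ∀ w, G.IsWalk i w j → ¬ IsConnecting i w C

/-- The minimal preorder for `G`, as a relation: `i ≲ j` iff `i = j` or `j` is an anterior
of `i`. -/
def MixedGraph.minimalPreorder {V : Type*} (G : MixedGraph V) (i j : V) : Prop :=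
  i = j ∨ G.IsAnterior j i

/-! ## Independence models -/

/-- Three pairwise disjoint sets. -/
def Disjoint3 {V : Type*} (A B C : Set V) : Prop :=
  Disjoint A B ∧ Disjoint A C ∧ Disjoint B C

/-- An independence model over `V`: a set of statements `⟨A, B | C⟩` (written `J.Indep A B C`)
with `A`, `B`, `C` disjoint, containing all those with `A` or `B` empty. -/
structure IndepModel (V : Type*) where
  Indep : Set V → Set V → Set V → Prop
  disjoint : ∀ A B C, Indep A B C → Disjoint3 A B C
  empty_left : ∀ B C, Disjoint B C → Indep ∅ B C
  empty_right : ∀ A C, Disjoint A C → Indep A ∅ C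

/-- Symmetry, decomposition, weak union, contraction, intersection and composition, for pairwise
disjoint sets. -/
structure IndepModel.IsCompositionalGraphoid {V : Type*} (J : IndepModel V) : Prop where
  symmetry : ∀ A B C, Disjoint3 A B C → (J.Indep A B C ↔ J.Indep B A C)
  decomposition : ∀ A B C D, Disjoint3 A B C → Disjoint3 A D C → Disjoint B D →
    J.Indep A (B ∪ D) C → J.Indep A B C ∧ J.Indep A D C
  weak_union : ∀ A B C D, Disjoint3 A B C → Disjoint3 A D C → Disjoint B D →
    J.Indep A (B ∪ D) C → J.Indep A B (C ∪ D) ∧ J.Indep A D (C ∪ B)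
  contraction : ∀ A B C D, Disjoint3 A B C → Disjoint3 A D C → Disjoint B D →
    J.Indep A B (C ∪ D) → J.Indep A D C → J.Indep A (B ∪ D) C
  intersection : ∀ A B C D, Disjoint3 A B C → Disjoint3 A D C → Disjoint B D →
    J.Indep A B (C ∪ D) → J.Indep A D (C ∪ B) → J.Indep A (B ∪ D) C
  composition : ∀ A B C D, Disjoint3 A B C → Disjoint3 A D C → Disjoint B D →
    J.Indep A B C → J.Indep A D C → J.Indep A (B ∪ D) C

/-- The skeleton of `J`: distinct nodes `i` and `j` are joined iff there is no `C ⊆ V \ {i, j}`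
such that `i` and `j` are independent given `C`. -/
def IndepModel.skeleton {V : Type*} (J : IndepModel V) : SimpleGraph V where
  Adj i j := i ≠ j ∧ ¬ ∃ C : Set V, C ⊆ {i, j}ᶜ ∧ (J.Indep {i} {j} C ∨ J.Indep {j} {i} C)
  symm := ⟨by
    rintro i j ⟨hne, h⟩
    refine ⟨hne.symm, ?_⟩
    rintro ⟨C, hC, h'⟩
    exact h ⟨C, by rwa [Set.pair_comm] at hC, h'.symm⟩⟩
  loopless := ⟨fun _ h => h.1 rfl⟩

/-- `J` is (globally) Markov to `G`. -/
def IndepModel.IsMarkov {V : Type*} (J : IndepModel V) (G : MixedGraph V) : Prop :=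
  ∀ A B C : Set V, Disjoint3 A B C → G.Separated A B C → J.Indep A B C

/-- `J` is minimally Markov to `G`. -/
def IndepModel.IsMinimallyMarkov {V : Type*} (J : IndepModel V) (G : MixedGraph V) : Prop :=
  J.IsMarkov G ∧ G.skeleton = J.skeleton

/-- The dependence graph `G(J, ≲)`: the edges of the skeleton of `J` are directed according to
the preorder `≲`, given as the relation `le`. -/
def IndepModel.dependenceGraph {V : Type*} (J : IndepModel V) (le : V → V → Prop) :
    MixedGraph V where
  line i j := J.skeleton.Adj i j ∧ le i j ∧ le j i
  arrow i j := J.skeleton.Adj i j ∧ le j i ∧ ¬ le i j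
  arc i j := J.skeleton.Adj i j ∧ ¬ le i j ∧ ¬ le j i
  line_symm _ _ h := ⟨h.1.symm, h.2.2, h.2.1⟩
  arc_symm _ _ h := ⟨h.1.symm, h.2.2, h.2.1⟩
  line_irrefl _ h := h.1.ne rfl
  arrow_irrefl _ h := h.1.ne rfl
  arc_irrefl _ h := h.1.ne rfl

/-- The preorder `le` is `J`-compatible: it is the minimal preorder for `G(J, ≲)`. -/
def IndepModel.IsCompatible {V : Type*} (J : IndepModel V) (le : V → V → Prop) : Prop :=
  ∀ i j, le i j ↔ (J.dependenceGraph le).minimalPreorder i j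

/-- Ordered upward-stability with respect to the preorder `le`. -/
def IndepModel.OrderedUpwardStable {V : Type*} (J : IndepModel V) (le : V → V → Prop) : Prop :=
  ∀ (i j : V) (C : Set V), J.Indep {i} {j} C → ∀ k : V, k ≠ i → k ≠ j →
    ((le i k ∨ le j k) ∨ ∃ l ∈ C, le l k ∧ le k l) → J.Indep {i} {j} (C ∪ {k})

/-- Ordered downward-stability with respect to the preorder `le`. -/
def IndepModel.OrderedDownwardStable {V : Type*} (J : IndepModel V) (le : V → V → Prop) : Prop :=
  ∀ (i j : V) (C : Set V), J.Indep {i} {j} C → ∀ k : V, k ≠ i → k ≠ j →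
    (¬ le i k ∧ ¬ le j k) → (∀ l ∈ C \ {k}, ¬ (le l k ∧ ¬ le k l)) → J.Indep {i} {j} (C \ {k})

end IndepGraph

namespace IndepGraph

open Relation

variable {V : Type*}

/-! ## Graphs ordered by a preorder -/

/-! Going up in the preorder means going to anteriors. Three ideas carry the theorem.

Stability gives a pairwise Markov property: non-adjacent `i`, `j` are independent given the other
nodes above them (`indep_upper_pair`).

This extends to any up-closed set `U` (`indep_of_not_colliderConnected`): two blocks that no edge
and no walk in `U` with only collider sections joins are independent given the rest of `U`. The
reason is that a minimal class of `U` acts as a collider, since every edge reaching it from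
elsewhere in `U` has an arrowhead there. Hence it cannot be connected to both of two blocks that are
not connected to each other, and it can be peeled off by induction and put back by the graphoid
axioms.

For `S`, `T` separated given `C`, let `U` be the set of nodes above `S ∪ T ∪ C`, and let `A` consist
of the nodes of `U \ C` with a connecting walk to `T`. A collider connection in `U` cannot leave `A`
within `U \ C`, because each of its sections can be made admissible: above `C` by a detour down to
`C`, above `T` by a fresh descent to `T`, while above `S` a descent to `S` would contradict
separation. All pairs across the split are thus independent given the rest of `U`; intersection
merges them into a statement given exactly `C`, and decomposition restricts it to `S` and `T`. -/

/-- One step of an anterior walk. -/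
def MixedGraph.Descends (G : MixedGraph V) (i j : V) : Prop :=
  G.line i j ∨ G.arrow i j

/-- The preorder `le` is generated by the lines and arrows of `G`, and arrows are strict. -/
structure MixedGraph.IsOrderedBy (G : MixedGraph V) (le : V → V → Prop) : Prop where
  refl : ∀ i, le i i
  trans : ∀ {i j k}, le i j → le j k → le i k
  le_of_line : ∀ {i j}, G.line i j → le i j
  le_of_arrow : ∀ {i j}, G.arrow i j → le j i
  not_le_of_arrow : ∀ {i j}, G.arrow i j → ¬ le i j
  descends : ∀ {i j}, le i j → ReflTransGen G.Descends j i

theorem MixedGraph.IsOrderedBy.le_of_descends {G : MixedGraph V} {le : V → V → Prop}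
    (hG : G.IsOrderedBy le) {i j : V} (h : G.Descends i j) : le j i :=
  h.elim (fun h => hG.le_of_line (G.line_symm _ _ h)) hG.le_of_arrow

theorem MixedGraph.IsOrderedBy.le_of_reflTransGen {G : MixedGraph V} {le : V → V → Prop}
    (hG : G.IsOrderedBy le) {i j : V} (h : ReflTransGen G.Descends i j) : le j i := by
  induction h with
  | refl => exact hG.refl _
  | tail _ hs ih => exact hG.trans (hG.le_of_descends hs) ih

/-- Equivalent nodes are joined by a walk of lines. -/
theorem MixedGraph.IsOrderedBy.lines {G : MixedGraph V} {le : V → V → Prop}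
    (hG : G.IsOrderedBy le) {i j : V} (h : le i j) (h' : le j i) :
    ReflTransGen G.line j i := by
  -- A descending walk between equivalent nodes contains no arrow: an arrow drops strictly, and
  -- nothing later climbs back.
  have key : ∀ k, ReflTransGen G.Descends k i → le k i → ReflTransGen G.line k i := by
    intro k hk
    induction hk using ReflTransGen.head_induction_on with
    | refl => exact fun _ => .refl
    | head hs hp ih =>
      intro hki
      rcases hs with hl | ha
      · exact .head hl (ih (hG.trans (hG.le_of_line (G.line_symm _ _ hl)) hki))
      · exact absurd (hG.trans hki (hG.le_of_reflTransGen hp)) (hG.not_le_of_arrow ha)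
  exact key j (hG.descends h) h'

theorem MixedGraph.IsWalk.descends {G : MixedGraph V} {i j : V} {w : List (Mark × V)}
    (h : G.IsWalk i w j) (hw : ∀ x ∈ w, x.1 = Mark.line ∨ x.1 = Mark.fwd) :
    ReflTransGen G.Descends i j := by
  induction h with
  | nil => exact .refl
  | cons he _ ih =>
    refine .head ?_ (ih fun x hx => hw x (List.mem_cons_of_mem _ hx))
    rcases hw _ List.mem_cons_self with h | h <;> simp only at h <;> subst h
    · exact Or.inl he
    · exact Or.inr he

theorem IndepModel.IsCompatible.isOrderedBy {J : IndepModel V} {le : V → V → Prop}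
    (hcompat : J.IsCompatible le) (hle : IsPreorder V le) :
    (J.dependenceGraph le).IsOrderedBy le where
  refl := hle.refl
  trans := hle.trans _ _ _
  le_of_line h := h.2.1
  le_of_arrow h := h.2.1
  not_le_of_arrow h := h.2.2
  descends {i j} h := by
    rcases (hcompat i j).1 h with rfl | ⟨_, w, hw, hs⟩
    · exact .refl
    · exact hw.descends (hs.elim (fun h => h.2) fun h x hx => Or.inl (h x hx))

theorem IndepModel.skeleton_dependenceGraph (J : IndepModel V) (le : V → V → Prop) :
    (J.dependenceGraph le).skeleton = J.skeleton := by
  ext i j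
  simp only [MixedGraph.skeleton, dependenceGraph]
  have := J.skeleton.adj_comm i j
  tauto

/-! ## The pairwise Markov property -/

/-- The nodes that are above some node of `X`, including those of `X`. -/
def upper (le : V → V → Prop) (X : Set V) : Set V := {k | ∃ x ∈ X, le x k}

theorem exists_minimal_of_preorder [Finite V] {le : V → V → Prop} (hr : ∀ i, le i i)
    (ht : ∀ {i j k}, le i j → le j k → le i k) {D : Set V} (hD : D.Nonempty) :
    ∃ k ∈ D, ∀ l ∈ D, le l k → le k l := by
  let _ : Preorder V := { le := le, le_refl := hr, le_trans := fun _ _ _ => ht }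
  obtain ⟨k, hk⟩ := D.toFinite.exists_minimal hD
  exact ⟨k, hk.1, fun l hl h => hk.2 hl h⟩

/-- Upward-stability adds every node above `i` or `j` to a separating set; downward-stability then
deletes the remaining foreign nodes, minimal ones first, so that no conditioning node lies strictly
below the one deleted. -/
theorem IndepModel.indep_upper_pair [Finite V] {J : IndepModel V}
    (hJ : J.IsCompositionalGraphoid) {le : V → V → Prop} (hr : ∀ i, le i i)
    (ht : ∀ {i j k}, le i j → le j k → le i k) (hup : J.OrderedUpwardStable le)
    (hdown : J.OrderedDownwardStable le) {i j : V} (hij : i ≠ j) (hadj : ¬ J.skeleton.Adj i j) :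
    J.Indep {i} {j} (upper le {i, j} \ {i, j}) := by
  obtain ⟨C, hC⟩ : ∃ C, J.Indep {i} {j} C := by
    by_contra hcon
    refine hadj ⟨hij, ?_⟩
    rintro ⟨C, _, h | h⟩
    · exact hcon ⟨C, h⟩
    · exact hcon ⟨C, (hJ.symmetry _ _ _ (J.disjoint _ _ _ h)).1 h⟩
  have hadd : ∀ D : Set V, D ⊆ upper le {i, j} \ {i, j} → J.Indep {i} {j} (C ∪ D) := by
    intro D
    induction D, D.toFinite using Set.Finite.induction_on with
    | empty => intro _; simpa using hC
    | @insert k D _ _ ih =>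
      intro hD
      have hk := hD (Set.mem_insert _ _)
      have := hup i j _ (ih fun x hx => hD (Set.mem_insert_of_mem _ hx)) k
        (fun h => hk.2 (by simp [h])) (fun h => hk.2 (by simp [h]))
        (Or.inl (by simpa [upper] using hk.1))
      rwa [Set.union_assoc, Set.union_singleton] at this
  have hrem : ∀ n, ∀ D : Set V, D.ncard = n → Disjoint D (upper le {i, j}) →
      J.Indep {i} {j} (upper le {i, j} \ {i, j} ∪ D) →
      J.Indep {i} {j} (upper le {i, j} \ {i, j}) := by
    intro n
    induction n with
    | zero =>
      intro D hn _ h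
      rw [Set.ncard_eq_zero] at hn
      simpa [hn] using h
    | succ n ih =>
      intro D hn hdis h
      have hD0 : D.ncard ≠ 0 := by omega
      obtain ⟨k, hk, hmin⟩ := exists_minimal_of_preorder hr ht
        (Set.nonempty_of_ncard_ne_zero hD0)
      have hku : ¬ (le i k ∨ le j k) := fun h =>
        hdis.notMem_of_mem_left hk (by simpa [upper] using h)
      push Not at hku
      have hd := hdown i j _ h k (fun h => hku.1 (h ▸ hr k)) (fun h => hku.2 (h ▸ hr k)) hku
        (by
          rintro l ⟨hl | hl, _⟩ ⟨h1, h2⟩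
          · obtain ⟨x, hx, hxl⟩ := hl.1
            rcases hx with rfl | rfl
            · exact hku.1 (ht hxl h1)
            · exact hku.2 (ht hxl h1)
          · exact h2 (hmin l hl h1))
      refine ih (D \ {k}) ?_ (hdis.mono_left Set.sdiff_subset) ?_
      · rw [Set.ncard_sdiff_singleton_of_mem hk, hn]; rfl
      · have hkn : k ∉ upper le {i, j} \ {i, j} := fun h => hdis.notMem_of_mem_left hk h.1
        rwa [Set.union_sdiff_distrib, Set.sdiff_singleton_eq_self hkn] at hd
  have hfin := hadd _ subset_rfl
  have hdC := J.disjoint _ _ _ hC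
  refine hrem _ (C \ upper le {i, j}) rfl Set.disjoint_sdiff_left ?_
  convert hfin using 1
  ext x
  have hi : x ∈ C → x ≠ i := fun h h' => by
    subst h'; exact hdC.2.1.notMem_of_mem_left rfl h
  have hj : x ∈ C → x ≠ j := fun h h' => by
    subst h'; exact hdC.2.2.notMem_of_mem_left rfl h
  simp only [Set.mem_union, Set.mem_sdiff, Set.mem_insert_iff, Set.mem_singleton_iff]
  tauto

/-! ## Consequences of the graphoid axioms -/

section Graphoid

variable {J : IndepModel V} {A B D : Set V}

theorem IndepModel.IsCompositionalGraphoid.symm (hJ : J.IsCompositionalGraphoid) {C : Set V}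
    (h : J.Indep A B C) : J.Indep B A C :=
  (hJ.symmetry _ _ _ (J.disjoint _ _ _ h)).1 h

theorem IndepModel.IsCompositionalGraphoid.mono_right (hJ : J.IsCompositionalGraphoid)
    {C : Set V} (h : J.Indep A B C) (hD : D ⊆ B) : J.Indep A D C := by
  have hd := J.disjoint _ _ _ h
  rw [← Set.union_sdiff_cancel hD] at h
  refine (hJ.decomposition A D C (B \ D) ?_ ?_ Set.disjoint_sdiff_right h).1
  · exact ⟨hd.1.mono_right hD, hd.2.1, hd.2.2.mono_left hD⟩
  · exact ⟨hd.1.mono_right Set.sdiff_subset, hd.2.1, hd.2.2.mono_left Set.sdiff_subset⟩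

/-- This and the next lemma put a peeled-off class `D` back into the conditioning set. Which one
applies depends on whether the independence of `A` and `D` is known without or with `B` in the
condition. -/
theorem IndepModel.IsCompositionalGraphoid.enlarge_of_composition
    (hJ : J.IsCompositionalGraphoid) {C : Set V} (hB : J.Indep A B C) (hD : J.Indep A D C)
    (hBD : Disjoint B D) : J.Indep A B (C ∪ D) :=
  have hB' := J.disjoint _ _ _ hB
  have hD' := J.disjoint _ _ _ hD
  (hJ.weak_union A B C D hB' hD' hBD (hJ.composition A B C D hB' hD' hBD hB hD)).1

theorem IndepModel.IsCompositionalGraphoid.enlarge_of_contraction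
    (hJ : J.IsCompositionalGraphoid) {C : Set V} (hB : J.Indep A B C)
    (hD : J.Indep A D (C ∪ B)) : J.Indep A B (C ∪ D) :=
  have hB' := J.disjoint _ _ _ hB
  have hd := J.disjoint _ _ _ hD
  have hD' : Disjoint3 A D C :=
    ⟨hd.1, hB'.2.1, hd.2.2.mono_right Set.subset_union_left⟩
  have hDB : Disjoint D B := hd.2.2.mono_right Set.subset_union_right
  (hJ.weak_union A D C B hD' hB' hDB (hJ.contraction A D C B hD' hB' hDB hD hB)).2

/-- Each premise conditions on everything else in `U`, which is the shape that intersection merges,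
one node at a time. -/
theorem IndepModel.IsCompositionalGraphoid.indep_of_forall_right [Finite V]
    (hJ : J.IsCompositionalGraphoid) {U : Set V} (hB : B ⊆ U) (hAB : Disjoint A B)
    (h : ∀ b ∈ B, J.Indep A {b} (U \ (A ∪ {b}))) : J.Indep A B (U \ (A ∪ B)) := by
  induction B, B.toFinite using Set.Finite.induction_on with
  | empty =>
    exact J.empty_right _ _ (Set.disjoint_left.2 fun x hx hx' => hx'.2 (Or.inl hx))
  | @insert k B hk _ ih =>
    rw [Set.insert_subset_iff] at hB
    rw [Set.disjoint_insert_right] at hAB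
    have h1 := ih hB.2 hAB.2 fun b hb => h b (Set.mem_insert_of_mem _ hb)
    have h2 := h k (Set.mem_insert _ _)
    have hc : ∀ x ∈ B, x ∈ U ∧ x ∉ A ∧ x ≠ k := fun x hx =>
      ⟨hB.2 hx, fun hA => hAB.2.notMem_of_mem_left hA hx, fun hxk => hk (hxk ▸ hx)⟩
    have e1 : U \ (A ∪ B) = U \ (A ∪ insert k B) ∪ {k} := by
      ext x
      by_cases hxk : x = k
      · subst hxk; simp [hB.1, hAB.1, hk]
      · simp [hxk]
    have e2 : U \ (A ∪ {k}) = U \ (A ∪ insert k B) ∪ B := by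
      ext x
      have := hc x
      simp only [Set.mem_union, Set.mem_sdiff, Set.mem_insert_iff, Set.mem_singleton_iff]
      tauto
    have d1 := J.disjoint _ _ _ h1
    have d2 := J.disjoint _ _ _ h2
    have hs : U \ (A ∪ insert k B) ⊆ U \ (A ∪ B) := e1 ▸ Set.subset_union_left
    have hs' : U \ (A ∪ insert k B) ⊆ U \ (A ∪ {k}) := e2 ▸ Set.subset_union_left
    have := hJ.intersection A B (U \ (A ∪ insert k B)) {k}
      ⟨d1.1, d1.2.1.mono_right hs, d1.2.2.mono_right hs⟩
      ⟨d2.1, d2.2.1.mono_right hs', d2.2.2.mono_right hs'⟩ (by simpa using hk)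
      (e1 ▸ h1) (e2 ▸ h2)
    rwa [Set.union_singleton] at this

theorem IndepModel.IsCompositionalGraphoid.indep_of_forall_pair [Finite V]
    (hJ : J.IsCompositionalGraphoid) {U : Set V} (hA : A ⊆ U) (hB : B ⊆ U) (hAB : Disjoint A B)
    (h : ∀ a ∈ A, ∀ b ∈ B, J.Indep {a} {b} (U \ {a, b})) : J.Indep A B (U \ (A ∪ B)) := by
  rw [Set.union_comm]
  refine hJ.symm (hJ.indep_of_forall_right hA hAB.symm fun a ha => ?_)
  rw [Set.union_comm]
  refine hJ.symm (hJ.indep_of_forall_right hB ?_ fun b hb => ?_)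
  · simpa using fun hb => hAB.notMem_of_mem_left ha hb
  · rw [Set.singleton_union]
    exact h a ha b hb

end Graphoid

/-! ## Collider connections in an up-closed set -/

/-- `k` is reached from `x` by a walk in `U` that starts with an arrowhead pointing away from `x`
and all of whose later sections are collider sections; sections are replaced by equivalence
classes. -/
inductive MixedGraph.ColliderReach (G : MixedGraph V) (le : V → V → Prop) (U : Set V) (x : V) :
    V → Prop
  | edge {k : V} {e : Mark} : G.Edge x e k → e.HeadAtTarget → k ∈ U → G.ColliderReach le U x k
  | equiv {k l : V} : G.ColliderReach le U x k → le k l → le l k → l ∈ U →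
      G.ColliderReach le U x l
  | arc {k l : V} : G.ColliderReach le U x k → G.arc k l → l ∈ U → G.ColliderReach le U x l

/-- Some nodes of `X` and `Y` are adjacent or joined by a walk in `U` with only collider sections
in between. -/
def MixedGraph.ColliderConnected (G : MixedGraph V) (le : V → V → Prop) (U X Y : Set V) : Prop :=
  ∃ x ∈ X, ∃ y ∈ Y, G.skeleton.Adj x y ∨
    ∃ m, G.ColliderReach le U x m ∧ G.ColliderReach le U y m

theorem MixedGraph.ColliderReach.mono {G : MixedGraph V} {le : V → V → Prop} {U W : Set V}
    (hUW : U ⊆ W) {x k : V} (h : G.ColliderReach le U x k) : G.ColliderReach le W x k := by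
  induction h with
  | edge he hh hk => exact .edge he hh (hUW hk)
  | equiv _ h1 h2 hl ih => exact .equiv ih h1 h2 (hUW hl)
  | arc _ ha hl ih => exact .arc ih ha (hUW hl)

theorem MixedGraph.ColliderReach.mem {G : MixedGraph V} {le : V → V → Prop} {U : Set V}
    {x k : V} (h : G.ColliderReach le U x k) : k ∈ U := by
  cases h <;> assumption

theorem MixedGraph.ColliderConnected.mono {G : MixedGraph V} {le : V → V → Prop} {U W X Y : Set V}
    (hUW : U ⊆ W) (h : G.ColliderConnected le U X Y) : G.ColliderConnected le W X Y := by
  obtain ⟨x, hx, y, hy, h | ⟨m, h1, h2⟩⟩ := h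
  · exact ⟨x, hx, y, hy, Or.inl h⟩
  · exact ⟨x, hx, y, hy, Or.inr ⟨m, h1.mono hUW, h2.mono hUW⟩⟩

theorem MixedGraph.ColliderConnected.symm {G : MixedGraph V} {le : V → V → Prop} {U X Y : Set V}
    (h : G.ColliderConnected le U X Y) : G.ColliderConnected le U Y X := by
  obtain ⟨x, hx, y, hy, h | ⟨m, h1, h2⟩⟩ := h
  · exact ⟨y, hy, x, hx, Or.inl h.symm⟩
  · exact ⟨y, hy, x, hx, Or.inr ⟨m, h2, h1⟩⟩

/-- `M` is an equivalence class of the preorder that is minimal within `U`. -/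
def IsMinimalClass (le : V → V → Prop) (U M : Set V) : Prop :=
  ∃ m ∈ U, M = {k | le m k ∧ le k m} ∧ ∀ u ∈ U, le u m → le m u

/-- `U` is closed under going up. -/
def IsUpClosed (le : V → V → Prop) (U : Set V) : Prop := ∀ x ∈ U, ∀ k, le x k → k ∈ U

/-- `X` is a nonempty set of equivalent nodes. -/
def IsBlock (le : V → V → Prop) (X : Set V) : Prop := X.Nonempty ∧ ∀ x ∈ X, ∀ y ∈ X, le x y

/-! ### Minimal classes act as colliders -/

section MinimalClass

variable {G : MixedGraph V} {le : V → V → Prop} {U M X Y : Set V}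

theorem IsMinimalClass.isBlock (hG : G.IsOrderedBy le) (hM : IsMinimalClass le U M) :
    IsBlock le M := by
  obtain ⟨m, hm, rfl, _⟩ := hM
  exact ⟨⟨m, hG.refl m, hG.refl m⟩, fun x hx y hy => hG.trans hx.2 hy.1⟩

theorem IsMinimalClass.subset (hU : IsUpClosed le U) (hM : IsMinimalClass le U M) : M ⊆ U := by
  obtain ⟨m, hm, rfl, _⟩ := hM
  exact fun x hx => hU m hm x hx.1

theorem IsMinimalClass.mem_of_le (hG : G.IsOrderedBy le) (hM : IsMinimalClass le U M) {x k : V}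
    (hx : x ∈ M) (hk : k ∈ U) (h : le k x) : k ∈ M := by
  obtain ⟨m, hm, rfl, hmin⟩ := hM
  have := hG.trans h hx.2
  exact ⟨hmin k hk this, this⟩

theorem IsMinimalClass.isUpClosed_sdiff (hG : G.IsOrderedBy le) (hU : IsUpClosed le U)
    (hM : IsMinimalClass le U M) : IsUpClosed le (U \ M) := fun x hx k hk =>
  ⟨hU x hx.1 k hk, fun hkM => hx.2 (hM.mem_of_le hG hkM hx.1 hk)⟩

/-- A line, or an arrow leaving `M`, would lead to a node below `M`, which minimality puts in `M`;
so the edge has an arrowhead at `m`. -/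
theorem IsMinimalClass.colliderReach_of_edge (hG : G.IsOrderedBy le) (hU : IsUpClosed le U)
    (hM : IsMinimalClass le U M) {x m : V} (hxU : x ∈ U) (hx : x ∉ M) (hm : m ∈ M)
    (h : G.skeleton.Adj x m) : G.ColliderReach le U x m := by
  have hmU := hM.subset hU hm
  rcases h with h | h | h | h
  · exact absurd (hM.mem_of_le hG hm hxU (hG.le_of_line h)) hx
  · exact .edge (e := .fwd) h (Or.inl rfl) hmU
  · exact absurd (hM.mem_of_le hG hm hxU (hG.le_of_arrow h)) hx
  · exact .edge (e := .arc) h (Or.inr rfl) hmU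

/-- The walk from `m` is traversed backwards. Only an initial arrow out of `m` could fail to
reverse, but minimality puts its head in `M`, so an equivalence step replaces it. -/
theorem IsMinimalClass.colliderReach_trans (hG : G.IsOrderedBy le) (hU : IsUpClosed le U)
    (hM : IsMinimalClass le U M) {x m n : V} (hm : m ∈ M)
    (hmn : G.ColliderReach le U m n) (hxn : G.ColliderReach le U x n) :
    G.ColliderReach le U x m := by
  have hmU := hM.subset hU hm
  induction hmn with
  | @edge k e he hh hk =>
    rcases hh with rfl | rfl
    · have hle : le k m := hG.le_of_arrow he
      exact .equiv hxn hle ((hM.isBlock hG).2 _ hm _ (hM.mem_of_le hG hm hk hle)) hmU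
    · exact .arc hxn (G.arc_symm _ _ he) hmU
  | equiv hk h1 h2 hl ih => exact ih (.equiv hxn h2 h1 hk.mem)
  | arc hk ha hl ih => exact ih (.arc hxn (G.arc_symm _ _ ha) hk.mem)

theorem IsMinimalClass.exists_colliderReach (hG : G.IsOrderedBy le) (hU : IsUpClosed le U)
    (hM : IsMinimalClass le U M) (hX : X ⊆ U) (hXM : Disjoint X M)
    (h : G.ColliderConnected le U X M) : ∃ x ∈ X, ∃ m ∈ M, G.ColliderReach le U x m := by
  obtain ⟨x, hx, m, hm, h | ⟨n, h1, h2⟩⟩ := h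
  · exact ⟨x, hx, m, hm,
      hM.colliderReach_of_edge hG hU (hX hx) (hXM.notMem_of_mem_left hx) hm h⟩
  · exact ⟨x, hx, m, hm, hM.colliderReach_trans hG hU hm h2 h1⟩

theorem IsMinimalClass.colliderConnected (hG : G.IsOrderedBy le) (hU : IsUpClosed le U)
    (hM : IsMinimalClass le U M) (hX : X ⊆ U) (hY : Y ⊆ U) (hXM : Disjoint X M)
    (hYM : Disjoint Y M) (hXc : G.ColliderConnected le U X M)
    (hYc : G.ColliderConnected le U Y M) : G.ColliderConnected le U X Y := by
  obtain ⟨x, hx, m, hm, h⟩ := hM.exists_colliderReach hG hU hX hXM hXc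
  obtain ⟨y, hy, n, hn, h'⟩ := hM.exists_colliderReach hG hU hY hYM hYc
  have hb := (hM.isBlock hG).2
  exact ⟨x, hx, y, hy, Or.inr ⟨m, h, .equiv h' (hb _ hn _ hm) (hb _ hm _ hn)
    (hM.subset hU hm)⟩⟩

end MinimalClass

open Classical in
/-- Disjoint blocks of an up-closed set that are not collider connected are independent given
the rest of the set. -/
theorem IndepModel.IsCompositionalGraphoid.indep_of_not_colliderConnected [Finite V]
    {J : IndepModel V} (hJ : J.IsCompositionalGraphoid) {G : MixedGraph V} {le : V → V → Prop}
    (hG : G.IsOrderedBy le)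
    (hpair : ∀ i j, i ≠ j → ¬ G.skeleton.Adj i j → J.Indep {i} {j} (upper le {i, j} \ {i, j})) :
    ∀ (n : ℕ) (U X Y : Set V), 3 * U.ncard + (if IsMinimalClass le U X then 0 else 1) +
      (if IsMinimalClass le U Y then 0 else 1) = n → IsUpClosed le U → IsBlock le X →
      IsBlock le Y → X ⊆ U → Y ⊆ U → Disjoint X Y → ¬ G.ColliderConnected le U X Y →
      J.Indep X Y (U \ (X ∪ Y)) := by
  -- The weight 3 pays for removing a class: the size drops by at least 1 while the two indicators
  -- rise by at most 2. The indicators allow a non-minimal block to be exchanged for a minimal one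
  -- within the same `U`.
  intro n
  induction n using Nat.strong_induction_on with
  | _ n ih =>
  intro U X Y hn hU hX hY hXU hYU hXY hc
  -- If nothing lies outside the up-set of the two blocks, each pair `a`, `b` already generates `U`,
  -- so the pairwise property conditions on the rest of `U`.
  by_cases hUe : U ⊆ upper le (X ∪ Y)
  · refine hJ.indep_of_forall_pair hXU hYU hXY fun a ha b hb => ?_
    have hab : upper le {a, b} = U := by
      ext u
      constructor
      · rintro ⟨x, rfl | rfl, hx⟩
        · exact hU _ (hXU ha) _ hx
        · exact hU _ (hYU hb) _ hx
      · intro hu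
        obtain ⟨x, hx | hx, hxu⟩ := hUe hu
        · exact ⟨a, Or.inl rfl, hG.trans (hX.2 a ha x hx) hxu⟩
        · exact ⟨b, Or.inr rfl, hG.trans (hY.2 b hb x hx) hxu⟩
    rw [← hab]
    exact hpair a b (fun h => hXY.notMem_of_mem_left ha (h ▸ hb))
      fun h => hc ⟨a, ha, b, hb, Or.inl h⟩
  -- Anything in `U` below `k` is also outside the up-set, so the class of `k` is minimal in all of
  -- `U`.
  obtain ⟨k, hk, hmin⟩ := exists_minimal_of_preorder hG.refl hG.trans
    (D := U \ upper le (X ∪ Y)) (Set.nonempty_of_not_subset hUe)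
  obtain ⟨M, hM, hkM, hMd⟩ : ∃ M, IsMinimalClass le U M ∧ k ∈ M ∧ Disjoint (X ∪ Y) M := by
    refine ⟨_, ⟨k, hk.1, rfl, fun u hu huk => hmin u ⟨hu, ?_⟩ huk⟩, ⟨hG.refl k, hG.refl k⟩, ?_⟩
    · rintro ⟨x, hx, hxu⟩
      exact hk.2 ⟨x, hx, hG.trans hxu huk⟩
    · exact Set.disjoint_left.2 fun x hx hxM => hk.2 ⟨x, hx, hxM.2⟩
  have hMU := hM.subset hU
  rw [Set.disjoint_union_left] at hMd
  have step : ∀ X Y : Set V, 3 * U.ncard + (if IsMinimalClass le U X then 0 else 1) +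
      (if IsMinimalClass le U Y then 0 else 1) = n → IsBlock le X → IsBlock le Y → X ⊆ U →
      Y ⊆ U → Disjoint X Y → Disjoint X M → Disjoint Y M → ¬ G.ColliderConnected le U X Y →
      ¬ G.ColliderConnected le U X M → J.Indep X Y (U \ (X ∪ Y)) := by
    clear! X Y
    intro X Y hn hX hY hXU hYU hXY hXM hYM hc hcM
    have hdecr : ∀ N ⊆ U, N.Nonempty → (U \ N).ncard < U.ncard := fun N hN hne =>
      Set.ncard_lt_ncard (sdiff_lt hN hne.ne_empty) (Set.toFinite _)
    have hle : ∀ P : Prop, (if P then 0 else 1) ≤ 1 := fun P => by split_ifs <;> simp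
    have h1 : J.Indep X Y ((U \ M) \ (X ∪ Y)) := by
      refine ih _ ?_ (U \ M) X Y rfl (hM.isUpClosed_sdiff hG hU) hX hY
        (Set.subset_sdiff.2 ⟨hXU, hXM⟩) (Set.subset_sdiff.2 ⟨hYU, hYM⟩) hXY
        fun h => hc (h.mono Set.sdiff_subset)
      have := hdecr M hMU ⟨k, hkM⟩
      have := hle (IsMinimalClass le (U \ M) X)
      have := hle (IsMinimalClass le (U \ M) Y)
      omega
    have e : U \ (X ∪ Y) = (U \ M) \ (X ∪ Y) ∪ M := by
      ext x
      have h1 : x ∈ M → x ∈ U := fun h => hMU h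
      have h2 : x ∈ X → x ∉ M := fun h => hXM.notMem_of_mem_left h
      have h3 : x ∈ Y → x ∉ M := fun h => hYM.notMem_of_mem_left h
      simp only [Set.mem_union, Set.mem_sdiff]
      tauto
    rw [e]
    -- If `Y` is itself a minimal class, it can be peeled off instead, which gives `X` and `M`
    -- independent without `Y` in the condition. Otherwise exchanging `Y` for the minimal `M` lowers
    -- the measure with `U` unchanged, and `Y` stays in the condition.
    by_cases hYm : IsMinimalClass le U Y
    · refine hJ.enlarge_of_composition h1 ?_ hYM
      have h2 : J.Indep X M ((U \ Y) \ (X ∪ M)) := by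
        refine ih _ ?_ (U \ Y) X M rfl (hYm.isUpClosed_sdiff hG hU) hX (hM.isBlock hG)
          (Set.subset_sdiff.2 ⟨hXU, hXY⟩) (Set.subset_sdiff.2 ⟨hMU, hYM.symm⟩) hXM
          fun h => hcM (h.mono Set.sdiff_subset)
        have := hdecr Y hYU hY.1
        have := hle (IsMinimalClass le (U \ Y) X)
        have := hle (IsMinimalClass le (U \ Y) M)
        omega
      convert h2 using 1
      ext x
      simp only [Set.mem_union, Set.mem_sdiff]
      tauto
    · refine hJ.enlarge_of_contraction h1 ?_
      have h2 : J.Indep X M (U \ (X ∪ M)) := by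
        refine ih _ ?_ U X M rfl hU hX (hM.isBlock hG) hXU hMU hXM hcM
        rw [if_neg hYm] at hn
        rw [if_pos hM]
        omega
      convert h2 using 1
      ext x
      have h1 : x ∈ Y → x ∈ U := fun h => hYU h
      have h2 : x ∈ X → x ∉ Y := fun h => hXY.notMem_of_mem_left h
      have h3 : x ∈ Y → x ∉ M := fun h => hYM.notMem_of_mem_left h
      simp only [Set.mem_union, Set.mem_sdiff]
      tauto
  by_cases hXM : G.ColliderConnected le U X M
  · have hYM : ¬ G.ColliderConnected le U Y M := fun h =>
      hc (hM.colliderConnected hG hU hXU hYU hMd.1 hMd.2 hXM h)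
    rw [Set.union_comm]
    exact hJ.symm (step Y X (by omega) hY hX hYU hXU hXY.symm hMd.2 hMd.1
      (fun h => hc h.symm) hYM)
  · exact step X Y hn hX hY hXU hYU hXY hMd.1 hMd.2 hc hXM

/-! ## Connecting walks, built from their last node -/

/-- The walk `w` from `i` satisfies the requirements of a connecting walk given `C` except
possibly at its first section; `hit` says whether that section meets `C`, and `exit` whether the
walk leaves it by an edge with an arrowhead at the section. -/
def ConnectsAfterFirstSection (i : V) (w : List (Mark × V)) (C : Set V) (hit exit : Prop) : Prop :=
  (∀ p s q, p ≠ [] → IsSection w p s q →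
    (IsCollider p q → (sectionNodes i p s ∩ C).Nonempty) ∧
    (¬ IsCollider p q → Disjoint (sectionNodes i p s) C)) ∧
  ∀ s q, IsSection w [] s q →
    ((sectionNodes i [] s ∩ C).Nonempty ↔ hit) ∧ ((∃ x ∈ q.head?, x.1.HeadAtSource) ↔ exit)

/-- The first section of a walk is never a collider section, so it only has to miss `C`. -/
theorem ConnectsAfterFirstSection.isConnecting {i : V} {w : List (Mark × V)} {C : Set V}
    {exit : Prop} (h : ConnectsAfterFirstSection i w C False exit) : IsConnecting i w C := by
  intro p s q hs
  by_cases hp : p = []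
  · subst hp
    refine ⟨fun hcol => ?_, fun _ => ?_⟩
    · obtain ⟨⟨x, hx, _⟩, _⟩ := hcol
      simp at hx
    · rw [Set.disjoint_iff_inter_eq_empty, ← Set.not_nonempty_iff_eq_empty, (h.2 s q hs).1]
      exact not_false
  · exact h.1 p s q hp hs

theorem connectsAfterFirstSection_nil (i : V) (C : Set V) :
    ConnectsAfterFirstSection i [] C (i ∈ C) False := by
  constructor
  · intro p s q hp hs
    have := hs.1
    simp only [List.nil_eq, List.append_eq_nil_iff] at this
    exact absurd this.1.1 hp
  · intro s q hs
    have := hs.1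
    simp only [List.nil_append, List.nil_eq, List.append_eq_nil_iff] at this
    obtain ⟨rfl, rfl⟩ := this
    simp [sectionNodes, lastNode, Set.Nonempty]

theorem isSection_cons_cons {e : Mark} {x : V} {y : Mark × V} {w p s q : List (Mark × V)}
    (h : IsSection ((e, x) :: w) ((e, x) :: y :: p) s q) : IsSection w (y :: p) s q := by
  obtain ⟨h1, h2, h3, h4⟩ := h
  refine ⟨by simpa using h1, h2, ?_, h4⟩
  simpa [List.getLast?_cons_cons] using h3

theorem isSection_cons_nil {e : Mark} {x : V} {w s q : List (Mark × V)}
    (h : IsSection ((e, x) :: w) [(e, x)] s q) : IsSection w [] s q := by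
  obtain ⟨h1, h2, h3, h4⟩ := h
  exact ⟨by simpa using h1, h2, by simp, h4⟩

/-- Compatibility of the remaining requirements when a walk is extended at its first node. -/
theorem ConnectsAfterFirstSection.cons_inner {x i : V} {e : Mark} {w : List (Mark × V)} {C : Set V}
    {hit exit : Prop} (h : ConnectsAfterFirstSection x w C hit exit)
    (he : e ≠ Mark.line → (hit ↔ e.HeadAtTarget ∧ exit)) {p s q : List (Mark × V)} (hp : p ≠ [])
    (hs : IsSection ((e, x) :: w) p s q) :
    (IsCollider p q → (sectionNodes i p s ∩ C).Nonempty) ∧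
      (¬ IsCollider p q → Disjoint (sectionNodes i p s) C) := by
  obtain ⟨z, p, rfl⟩ := List.exists_cons_of_ne_nil hp
  obtain rfl : (e, x) = z := by
    have := hs.1
    simp only [List.cons_append, List.cons.injEq] at this
    exact this.1
  cases p with
  | nil =>
    have hne : e ≠ Mark.line := by simpa using hs.2.2.1
    obtain ⟨h1, h2⟩ := h.2 s q (isSection_cons_nil hs)
    have hcol : IsCollider [(e, x)] q ↔ e.HeadAtTarget ∧ exit := by
      rw [← h2]; simp [IsCollider]
    rw [hcol, ← he hne, ← h1, Set.disjoint_iff_inter_eq_empty, ← Set.not_nonempty_iff_eq_empty]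
    exact ⟨id, id⟩
  | cons y p =>
    have := h.1 (y :: p) s q (List.cons_ne_nil _ _) (isSection_cons_cons hs)
    simpa [IsCollider, List.getLast?_cons_cons, sectionNodes, lastNode] using this

theorem ConnectsAfterFirstSection.line {i x : V} {w : List (Mark × V)} {C : Set V}
    {hit exit : Prop} (h : ConnectsAfterFirstSection x w C hit exit) :
    ConnectsAfterFirstSection i ((Mark.line, x) :: w) C (i ∈ C ∨ hit) exit := by
  refine ⟨fun p s q hp hs => h.cons_inner (fun hne => absurd rfl hne) hp hs, fun s q hs => ?_⟩
  obtain ⟨h1, h2, h3, h4⟩ := hs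
  cases s with
  | nil =>
    have hq : (Mark.line, x) :: w = q := by simpa using h1
    subst hq
    simp at h4
  | cons y s =>
    simp only [List.nil_append, List.cons_append, List.cons.injEq] at h1
    obtain ⟨rfl, rfl⟩ := h1
    obtain ⟨g1, g2⟩ := h.2 s q ⟨by simp, fun z hz => h2 z (List.mem_cons_of_mem _ hz), by simp, h4⟩
    refine ⟨?_, g2⟩
    rw [← g1]
    constructor
    · rintro ⟨z, hz | hz, hzC⟩
      · obtain rfl : z = i := hz
        exact Or.inl hzC
      · rw [List.map_cons, List.mem_cons] at hz
        exact Or.inr ⟨z, hz, hzC⟩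
    · rintro (hi | ⟨z, hz, hzC⟩)
      · exact ⟨i, Or.inl rfl, hi⟩
      · refine ⟨z, Or.inr ?_, hzC⟩
        rw [List.map_cons, List.mem_cons]
        exact hz

/-- A non-line edge turns the old first section into an inner one, for which `he` is exactly the
connecting condition. -/
theorem ConnectsAfterFirstSection.cons {i x : V} {e : Mark} {w : List (Mark × V)} {C : Set V}
    {hit exit : Prop} (h : ConnectsAfterFirstSection x w C hit exit) (hne : e ≠ Mark.line)
    (he : hit ↔ e.HeadAtTarget ∧ exit) :
    ConnectsAfterFirstSection i ((e, x) :: w) C (i ∈ C) e.HeadAtSource := by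
  refine ⟨fun p s q hp hs => h.cons_inner (fun _ => he) hp hs, fun s q hs => ?_⟩
  obtain ⟨h1, h2, h3, h4⟩ := hs
  cases s with
  | nil =>
    have hq : (e, x) :: w = q := by simpa using h1
    subst hq
    simp [sectionNodes, lastNode, Set.Nonempty]
  | cons y s =>
    simp only [List.nil_append, List.cons_append, List.cons.injEq] at h1
    obtain ⟨rfl, rfl⟩ := h1
    exact absurd (h2 _ List.mem_cons_self) hne

/-- Some walk from `i` to `T` satisfies the requirements of a connecting walk given `C` except
possibly at its first section, which has the properties recorded by `hit` and `exit`. -/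
def MixedGraph.Reaches (G : MixedGraph V) (le : V → V → Prop) (C T : Set V) (i : V)
    (hit exit : Prop) : Prop :=
  (hit → i ∈ upper le C) ∧ (i ∈ C → hit) ∧
    ∃ w, ∃ t ∈ T, G.IsWalk i w t ∧ ConnectsAfterFirstSection i w C hit exit

/-! ### Extending walks towards `T` at their first node -/

section Reaches

variable {G : MixedGraph V} {le : V → V → Prop} {S T C : Set V} {i x : V} {hit exit : Prop}

theorem MixedGraph.Reaches.congr {hit' exit' : Prop} (h : G.Reaches le C T i hit exit)
    (hh : hit ↔ hit') (he : exit ↔ exit') : G.Reaches le C T i hit' exit' := by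
  rwa [← propext hh, ← propext he]

theorem MixedGraph.reaches_self (hG : G.IsOrderedBy le) (hi : i ∈ T) :
    G.Reaches le C T i (i ∈ C) False :=
  ⟨fun h => ⟨i, h, hG.refl i⟩, id, [], i, hi, .nil i, connectsAfterFirstSection_nil i C⟩

theorem MixedGraph.Reaches.line (hG : G.IsOrderedBy le) (h : G.Reaches le C T x hit exit)
    (hl : G.line i x) : G.Reaches le C T i (i ∈ C ∨ hit) exit := by
  obtain ⟨h1, h2, w, t, ht, hw, hc⟩ := h
  refine ⟨?_, Or.inl, _, t, ht, .cons (e := .line) hl hw, hc.line⟩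
  rintro (h | h)
  · exact ⟨i, h, hG.refl i⟩
  · obtain ⟨c, hcC, hcx⟩ := h1 h
    exact ⟨c, hcC, hG.trans hcx (hG.le_of_line (G.line_symm _ _ hl))⟩

theorem MixedGraph.Reaches.cons (hG : G.IsOrderedBy le) (h : G.Reaches le C T x hit exit)
    {e : Mark} (he : G.Edge i e x) (hne : e ≠ Mark.line) (hh : hit ↔ e.HeadAtTarget ∧ exit) :
    G.Reaches le C T i (i ∈ C) e.HeadAtSource := by
  obtain ⟨h1, h2, w, t, ht, hw, hc⟩ := h
  exact ⟨fun h => ⟨i, h, hG.refl i⟩, id, _, t, ht, .cons he hw, hc.cons hne hh⟩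

theorem MixedGraph.Reaches.of_arrow (hG : G.IsOrderedBy le) (h : G.Reaches le C T x False exit)
    (ha : G.arrow x i) : G.Reaches le C T i (i ∈ C) True :=
  (h.cons hG (e := .bwd) ha (by simp) (by simp [Mark.HeadAtTarget])).congr Iff.rfl
    (by simp [Mark.HeadAtSource])

/-- Equal `hit` and `exit` make an incoming arrowhead admissible: both true gives a collider section
meeting `C`, both false a non-collider section missing `C`. -/
theorem MixedGraph.Reaches.arrow (hG : G.IsOrderedBy le) (h : G.Reaches le C T x hit hit)
    (ha : G.arrow i x) : G.Reaches le C T i (i ∈ C) False :=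
  (h.cons hG (e := .fwd) ha (by simp) (by simp [Mark.HeadAtTarget])).congr Iff.rfl
    (by simp [Mark.HeadAtSource])

theorem MixedGraph.Reaches.arc (hG : G.IsOrderedBy le) (h : G.Reaches le C T x hit hit)
    (ha : G.arc i x) : G.Reaches le C T i (i ∈ C) True :=
  (h.cons hG (e := .arc) ha (by simp) (by simp [Mark.HeadAtTarget])).congr Iff.rfl
    (by simp [Mark.HeadAtSource])

/-- The descent from `x` to `i` is prepended in reverse; it avoids `C` because no node of `C` lies
below `x`. -/
theorem MixedGraph.Reaches.down (hG : G.IsOrderedBy le) (h : G.Reaches le C T x False exit)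
    (hx : x ∉ upper le C) (hix : le i x) : ∃ exit', G.Reaches le C T i False exit' := by
  induction hG.descends hix with
  | refl => exact ⟨_, h⟩
  | @tail b c hb hs ih =>
    obtain ⟨exit', hb'⟩ := ih (hG.le_of_reflTransGen hb)
    have hc : c ∉ C := fun hc => hx ⟨c, hc, hix⟩
    rcases hs with hs | hs
    · exact ⟨_, (hb'.line hG (G.line_symm _ _ hs)).congr (by simp [hc]) Iff.rfl⟩
    · exact ⟨_, (hb'.of_arrow hG hs).congr (by simp [hc]) Iff.rfl⟩

theorem MixedGraph.reaches_of_upper (hG : G.IsOrderedBy le) (hx : x ∉ upper le C)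
    (hT : x ∈ upper le T) : G.Reaches le C T x False False := by
  obtain ⟨t, ht, htx⟩ := hT
  have hnot : ∀ {y}, y ∉ upper le C → y ∉ C := fun hy hyC => hy ⟨_, hyC, hG.refl _⟩
  induction hG.descends htx using ReflTransGen.head_induction_on with
  | refl => exact (reaches_self hG ht).congr (by simp [hnot hx]) Iff.rfl
  | @head a c hs hc ih =>
    have := ih (fun ⟨d, hd, hdc⟩ => hx ⟨d, hd, hG.trans hdc (hG.le_of_descends hs)⟩)
      (hG.le_of_reflTransGen hc)
    rcases hs with hs | hs
    · exact (this.line hG hs).congr (by simp [hnot hx]) Iff.rfl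
    · exact (this.arrow hG hs).congr (by simp [hnot hx]) Iff.rfl

/-- A walk whose first node is above `C` can be prolonged by going down to `C` and back. -/
theorem MixedGraph.Reaches.bounce (hG : G.IsOrderedBy le) (h : G.Reaches le C T x False exit)
    (hx : x ∈ upper le C) : ∃ b, G.Reaches le C T x b b := by
  obtain ⟨c, hc, hcx⟩ := hx
  induction hG.descends hcx using ReflTransGen.head_induction_on generalizing exit with
  | refl => exact (h.2.1 hc).elim
  | @head a d hs hd ih =>
    have haC : a ∉ C := h.2.1
    -- Without an arrowhead on leaving, the section is a non-collider missing `C`, and no detour is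
    -- needed.
    by_cases hexit : exit
    swap
    · exact ⟨False, h.congr Iff.rfl (by simp [hexit])⟩
    -- After one step down, either `C` has been hit and the section is an open collider, or the
    -- descent continues; afterwards the same edge is taken back up.
    have hready : ∀ {hit'}, (d ∉ C → ¬ hit') → (d ∈ C → hit') → G.Reaches le C T d hit' True →
        ∃ b, G.Reaches le C T d b b := by
      intro hit' h1 h2 h'
      by_cases hdC : d ∈ C
      · exact ⟨True, h'.congr (by simp [h2 hdC]) Iff.rfl⟩
      · exact ih (h'.congr (by simp [h1 hdC]) Iff.rfl) (hG.le_of_reflTransGen hd)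
    rcases hs with hs | hs
    · obtain ⟨b, hb⟩ := hready (by simp) Or.inl
        ((h.line hG (G.line_symm _ _ hs)).congr Iff.rfl (by simp [hexit]))
      exact ⟨b, (hb.line hG hs).congr (by simp [haC]) Iff.rfl⟩
    · obtain ⟨b, hb⟩ := hready id id (h.of_arrow hG hs)
      exact ⟨False, (hb.arrow hG hs).congr (by simp [haC]) Iff.rfl⟩

/-- Makes an incoming arrowhead admissible. If the first section misses `C`, there are three cases:
above `C`, bounce; above `S`, descend to a contradiction with `hsep`; above `T`, discard the walk
and descend to `T`. -/
theorem MixedGraph.Reaches.ready (hG : G.IsOrderedBy le)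
    (hsep : ∀ s ∈ S, ∀ exit, ¬ G.Reaches le C T s False exit) (hx : x ∈ upper le (S ∪ T ∪ C))
    (h : G.Reaches le C T x hit exit) (hh : hit → exit) : ∃ b, G.Reaches le C T x b b := by
  by_cases hhit : hit
  · exact ⟨True, h.congr (by simp [hhit]) (by simp [hh hhit])⟩
  have h' : G.Reaches le C T x False exit := h.congr (by simp [hhit]) Iff.rfl
  by_cases hxC : x ∈ upper le C
  · exact h'.bounce hG hxC
  obtain ⟨s, (hs | hs) | hs, hsx⟩ := hx
  · obtain ⟨exit', hr⟩ := h'.down hG hxC hsx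
    exact absurd hr (hsep s hs _)
  · exact ⟨False, reaches_of_upper hG hxC ⟨s, hs, hsx⟩⟩
  · exact absurd ⟨s, hs, hsx⟩ hxC

theorem MixedGraph.Reaches.equiv (hG : G.IsOrderedBy le) (h : G.Reaches le C T x hit exit)
    (h1 : le i x) (h2 : le x i) : ∃ hit', G.Reaches le C T i hit' exit := by
  induction hG.lines h2 h1 using ReflTransGen.head_induction_on with
  | refl => exact ⟨_, h⟩
  | head hs hc ih =>
    rename_i a c
    have hl := hG.le_of_line hs
    have hl' := hG.le_of_line (G.line_symm _ _ hs)
    obtain ⟨hit', h'⟩ := ih (hG.trans hl' h1) (hG.trans h2 hl)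
    exact ⟨_, h'.line hG hs⟩

theorem MixedGraph.Reaches.of_colliderReach (hG : G.IsOrderedBy le)
    (hsep : ∀ s ∈ S, ∀ exit, ¬ G.Reaches le C T s False exit)
    (h : G.Reaches le C T x False exit) (hx : x ∈ upper le (S ∪ T ∪ C))
    (hr : G.ColliderReach le (upper le (S ∪ T ∪ C)) x i) :
    ∃ hit', G.Reaches le C T i hit' True := by
  induction hr with
  | @edge k e he hh hk =>
    rcases hh with rfl | rfl
    · exact ⟨_, h.of_arrow hG he⟩
    · obtain ⟨b, hb⟩ := h.ready hG hsep hx False.elim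
      exact ⟨_, hb.arc hG (G.arc_symm _ _ he)⟩
  | equiv _ h1 h2 _ ih =>
    obtain ⟨hit', h'⟩ := ih
    exact h'.equiv hG h2 h1
  | arc hk ha _ ih =>
    obtain ⟨hit', h'⟩ := ih
    obtain ⟨b, hb⟩ := h'.ready hG hsep hk.mem fun _ => trivial
    exact ⟨_, hb.arc hG (G.arc_symm _ _ ha)⟩

/-- The collider walk is now prepended from its end `i` back to its start `x`; with the preceding
lemma, this crosses a whole collider connection. -/
theorem MixedGraph.Reaches.of_colliderReach_symm (hG : G.IsOrderedBy le)
    (hsep : ∀ s ∈ S, ∀ exit, ¬ G.Reaches le C T s False exit)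
    (hr : G.ColliderReach le (upper le (S ∪ T ∪ C)) x i)
    (h : G.Reaches le C T i hit True) : ∃ exit', G.Reaches le C T x (x ∈ C) exit' := by
  induction hr generalizing hit with
  | @edge k e he hh hk =>
    obtain ⟨b, hb⟩ := h.ready hG hsep hk fun _ => trivial
    rcases hh with rfl | rfl
    · exact ⟨_, hb.arrow hG he⟩
    · exact ⟨_, hb.arc hG he⟩
  | equiv _ h1 h2 _ ih =>
    obtain ⟨hit', h'⟩ := h.equiv hG h1 h2
    exact ih h'
  | arc _ ha hl ih =>
    obtain ⟨b, hb⟩ := h.ready hG hsep hl fun _ => trivial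
    exact ih (hb.arc hG ha)

theorem MixedGraph.Reaches.of_adj (hG : G.IsOrderedBy le)
    (hsep : ∀ s ∈ S, ∀ exit, ¬ G.Reaches le C T s False exit)
    (h : G.Reaches le C T x False exit) (hx : x ∈ upper le (S ∪ T ∪ C))
    (hadj : G.skeleton.Adj i x) : ∃ exit', G.Reaches le C T i (i ∈ C) exit' := by
  obtain ⟨b, hb⟩ := h.ready hG hsep hx False.elim
  rcases hadj with hl | ha | ha | ha
  · exact ⟨_, (h.line hG hl).congr (by simp) Iff.rfl⟩
  · exact ⟨_, hb.arrow hG ha⟩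
  · exact ⟨_, h.of_arrow hG ha⟩
  · exact ⟨_, hb.arc hG ha⟩

theorem isUpClosed_upper (hG : G.IsOrderedBy le) (X : Set V) : IsUpClosed le (upper le X) :=
  fun _ ⟨x, hx, hxk⟩ _ h => ⟨x, hx, hG.trans hxk h⟩

theorem subset_upper (hG : G.IsOrderedBy le) (X : Set V) : X ⊆ upper le X :=
  fun x hx => ⟨x, hx, hG.refl x⟩

end Reaches

/-! ### From pairwise to global Markov -/

theorem IndepModel.IsCompositionalGraphoid.isMarkov [Finite V] {J : IndepModel V}
    (hJ : J.IsCompositionalGraphoid) {G : MixedGraph V} {le : V → V → Prop}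
    (hG : G.IsOrderedBy le)
    (hpair : ∀ i j, i ≠ j → ¬ G.skeleton.Adj i j →
      J.Indep {i} {j} (upper le {i, j} \ {i, j})) : J.IsMarkov G := by
  intro S T C hd hS
  have hsep : ∀ s ∈ S, ∀ exit, ¬ G.Reaches le C T s False exit := by
    rintro s hs exit ⟨_, _, w, t, ht, hw, hc⟩
    exact hS s hs t ht w hw hc.isConnecting
  have hsub := subset_upper hG (S ∪ T ∪ C)
  set U := upper le (S ∪ T ∪ C) with hU
  set A : Set V := {x | x ∈ U ∧ x ∉ C ∧ ∃ exit, G.Reaches le C T x False exit} with hA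
  have hblock : ∀ x, IsBlock le {x} := fun x => ⟨⟨x, rfl⟩, by
    rintro _ rfl _ rfl
    exact hG.refl _⟩
  have hind : J.Indep ((U \ C) \ A) A (U \ (((U \ C) \ A) ∪ A)) := by
    refine hJ.indep_of_forall_pair (Set.sdiff_subset.trans Set.sdiff_subset) (fun x hx => hx.1)
      Set.disjoint_sdiff_left ?_
    rintro b ⟨⟨hbU, hbC⟩, hbA⟩ a ⟨haU, haC, exit, ha⟩
    have hab : b ≠ a := by
      rintro rfl
      exact hbA ⟨haU, haC, exit, ha⟩
    have hnot : ∀ exit', ¬ G.Reaches le C T b (b ∈ C) exit' := fun exit' h =>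
      hbA ⟨hbU, hbC, exit', h.congr (by simp [hbC]) Iff.rfl⟩
    have := hJ.indep_of_not_colliderConnected hG hpair _ U {b} {a} rfl (isUpClosed_upper hG _)
      (hblock b) (hblock a) (by simpa using hbU) (by simpa using haU) (by simpa using hab) ?_
    · rwa [Set.singleton_union] at this
    -- A connection between `b` and `a` would extend the walk from `a` to one from `b`, forcing `b`
    -- into `A`.
    · rintro ⟨_, rfl, _, rfl, h | ⟨m, h1, h2⟩⟩
      · obtain ⟨exit', h'⟩ := ha.of_adj hG hsep haU h
        exact hnot _ h'
      · obtain ⟨hit', h'⟩ := ha.of_colliderReach hG hsep haU h2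
        obtain ⟨exit', h''⟩ := h'.of_colliderReach_symm hG hsep h1
        exact hnot _ h''
  have hC : U \ (((U \ C) \ A) ∪ A) = C := by
    ext x
    have h1 : x ∈ C → x ∈ U := fun h => hsub (Or.inr h)
    have h2 : x ∈ A → x ∉ C := fun h => h.2.1
    simp only [Set.mem_union, Set.mem_sdiff]
    tauto
  rw [hC] at hind
  have hTA : T ⊆ A := fun t ht =>
    have htC : t ∉ C := hd.2.2.notMem_of_mem_left ht
    ⟨hsub (Or.inl (Or.inr ht)), htC, _, (MixedGraph.reaches_self hG ht).congr (by simp [htC])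
      Iff.rfl⟩
  have hSA : S ⊆ (U \ C) \ A := fun s hs =>
    ⟨⟨hsub (Or.inl (Or.inl hs)), hd.2.1.notMem_of_mem_left hs⟩,
      fun ⟨_, _, exit, h⟩ => hsep s hs exit h⟩
  exact hJ.mono_right (hJ.symm (hJ.mono_right (hJ.symm hind) hSA)) hTA

end IndepGraph

theorem mainTheorem2 {V : Type*} [Finite V] (J : IndepGraph.IndepModel V)
    (hJ : J.IsCompositionalGraphoid)
    (le : V → V → Prop) (hle : IsPreorder V le) (hcompat : J.IsCompatible le)
    (hup : J.OrderedUpwardStable le) (hdown : J.OrderedDownwardStable le) :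
    J.IsMinimallyMarkov (J.dependenceGraph le) := by
  have hsk := J.skeleton_dependenceGraph le
  refine ⟨hJ.isMarkov (hcompat.isOrderedBy hle) fun i j hij hadj => ?_, hsk⟩
  rw [hsk] at hadj
  exact IndepGraph.IndepModel.indep_upper_pair hJ hle.refl (hle.trans _ _ _) hup hdown hij hadj
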